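/- Let $Q:\mathbb R^n\to\mathbb R^{\ell}$ be continuously differentiable, $Z(x)=\begin{bmatrix}x\\Q(x)\end{bmatrix}\in\mathbb R^{s}$ with $s=n+\ell$, and consider the system $$\dot x=f(x)+Bu+Ed,\qquad y=h(x),\qquad e=y-r,$$ with state $x\in\mathbb R^n$, input $u\in\mathbb R^m$, output $y\in\mathbb R^p$, constant disturbance $d\in\mathbb R^q$ and constant reference $r\in\mathbb R^p$, where $f(x)=AZ(x)$ and $h(x)=CZ(x)$ for some matrices $A\in\mathbb R^{n\times s}$, $C\in\mathbb R^{p\times s}$. Let $R_Q\in\mathbb R^{n\times\tau}$ be such that $\frac{\partial Q}{\partial x}(x)^\top\frac{\partial Q}{\partial x}(x)\preceq R_QR_Q^\top$ for all $x\in\mathbb R^n$, and put $\mathcal R_Q=\begin{bmatrix}R_Q\\0_{p\times\tau}\end{bmatrix}$, $\mathcal Z(x,\xi)=\begin{bmatrix}x\\ \xi\\ Q(x)\end{bmatrix}$ for $\xi\in\mathbb R^p$. In an experiment on this system together with $\dot\xi=e$, carried out under some constant disturbance $d_{\rm e}$ and some constant reference $r_{\rm e}$, samples are taken at times $0\le t_0<\dots<t_{T-1}$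 and collected in the matrices $$U_0=\begin{bmatrix}u(t_0)&\cdots&u(t_{T-1})\end{bmatrix},\quad \mathcal Z_0=\begin{bmatrix}\mathcal Z(x(t_0),\xi(t_0))&\cdots&\mathcal Z(x(t_{T-1}),\xi(t_{T-1}))\end{bmatrix},\quad \mathcal Z_1=\begin{bmatrix}\dot x(t_0)&\cdots&\dot x(t_{T-1})\\ y(t_0)&\cdots&y(t_{T-1})\end{bmatrix}.$$ Suppose that the symmetric matrix $\mathcal P\in\mathbb R^{(n+p)\times(n+p)}$, $\mathcal Y_1\in\mathbb R^{T\times(n+p)}$, $\mathcal G_2\in\mathbb R^{T\times\ell}$ and $\alpha>0$ satisfy $\mathcal P\succ0$ and $$\mathcal Z_0\mathcal Y_1=\begin{bmatrix}\mathcal P\\0_{\ell\times(n+p)}\end{bmatrix},\quad \mathcal Z_0\mathcal G_2=\begin{bmatrix}0_{(n+p)\times\ell}\\I_\ell\end{bmatrix},\quad \begin{bmatrix}1&\cdots&1\end{bmatrix}\begin{bmatrix}\mathcal Y_1&\mathcal G_2\end{bmatrix}=0,$$ $$\begin{bmatrix}\mathcal Z_1\mathcal Y_1+(\mathcal Z_1\mathcal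 Y_1)^\top+\alpha I_{n+p}&\mathcal Z_1\mathcal G_2&\mathcal P\mathcal R_Q\\ \mathcal G_2^\top\mathcal Z_1^\top&-I_\ell&0\\ \mathcal R_Q^\top\mathcal P&0&-I_\tau\end{bmatrix}\preceq0,$$ and put $\mathcal K=U_0\begin{bmatrix}\mathcal Y_1\mathcal P^{-1}&\mathcal G_2\end{bmatrix}$. Then for every constant disturbance $d\in\mathbb R^q$ and every constant reference $r\in\mathbb R^p$ the closed-loop system $$\dot x=f(x)+B\mathcal K\mathcal Z(x,\xi)+Ed,\qquad \dot\xi=e,\qquad e=h(x)-r$$ has, from every initial condition in $\mathbb R^n\times\mathbb R^p$, a unique solution, which is defined for all $t\ge0$; every such solution $(x(t),\xi(t))$ is bounded on $[0,\infty)$, and $e(t)\to0$ as $t\to+\infty$. -/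

import Mathlib

open Set Filter Topology Matrix

noncomputable section

namespace IntegralControl

variable {n p m q ℓ τ T : ℕ}

/-- The Jacobian matrix `∂Q/∂x` at the point `x`. -/
def jacobian (Q : (Fin n → ℝ) → (Fin ℓ → ℝ)) (x : Fin n → ℝ) : Matrix (Fin ℓ) (Fin n) ℝ :=
  LinearMap.toMatrix' (fderiv ℝ Q x : (Fin n → ℝ) →ₗ[ℝ] (Fin ℓ → ℝ))

/-- The dictionary `Z(x) = [x; Q(x)]`, with `s = n + ℓ` entries. -/
def dictionary (Q : (Fin n → ℝ) → (Fin ℓ → ℝ)) (x : Fin n → ℝ) : Fin n ⊕ Fin ℓ → ℝ :=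
  Sum.elim x (Q x)

/-- The extended dictionary `𝒵(x, ξ) = [x; ξ; Q(x)]`. -/
def extDictionary (Q : (Fin n → ℝ) → (Fin ℓ → ℝ)) (x : Fin n → ℝ) (ξ : Fin p → ℝ) :
    (Fin n ⊕ Fin p) ⊕ Fin ℓ → ℝ :=
  Sum.elim (Sum.elim x ξ) (Q x)

/-- The signals `x, ξ, u, y` (functions of time `≥ 0`), sampled at the distinct times
`0 ≤ t 0 < t 1 < ⋯ < t (T - 1)`, come from an experiment on the system
`ẋ = f(x) + B u + E d`, `y = h(x)`, `ξ̇ = y - r` with constant `d` and `r`.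
The equations are only required at the sampling times, so that the input may be
discontinuous at other times. -/
structure IsExperiment (f : (Fin n → ℝ) → (Fin n → ℝ)) (h : (Fin n → ℝ) → (Fin p → ℝ))
    (B : Matrix (Fin n) (Fin m) ℝ) (E : Matrix (Fin n) (Fin q) ℝ)
    (d : Fin q → ℝ) (r : Fin p → ℝ) (t : Fin T → ℝ)
    (x : ℝ → (Fin n → ℝ)) (ξ : ℝ → (Fin p → ℝ))
    (u : ℝ → (Fin m → ℝ)) (y : ℝ → (Fin p → ℝ)) : Prop where
  times_nonneg : ∀ i, 0 ≤ t i
  times_strictMono : StrictMono t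
  state_eq : ∀ i, HasDerivWithinAt x (f (x (t i)) + B *ᵥ u (t i) + E *ᵥ d) (Ici 0) (t i)
  output_eq : ∀ i, y (t i) = h (x (t i))
  integrator_eq : ∀ i, HasDerivWithinAt ξ (y (t i) - r) (Ici 0) (t i)

/-- The data matrix `U₀`, with columns `u(tᵢ)`. -/
def dataU0 (t : Fin T → ℝ) (u : ℝ → (Fin m → ℝ)) : Matrix (Fin m) (Fin T) ℝ :=
  Matrix.of fun j i => u (t i) j

/-- The data matrix `𝒵₀`, with columns `[x(tᵢ); ξ(tᵢ); Q(x(tᵢ))]`. -/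
def dataZ0 (Q : (Fin n → ℝ) → (Fin ℓ → ℝ)) (t : Fin T → ℝ)
    (x : ℝ → (Fin n → ℝ)) (ξ : ℝ → (Fin p → ℝ)) :
    Matrix ((Fin n ⊕ Fin p) ⊕ Fin ℓ) (Fin T) ℝ :=
  Matrix.of fun j i => extDictionary Q (x (t i)) (ξ (t i)) j

/-- The data matrix `𝒵₁`, with columns `[ẋ(tᵢ); y(tᵢ)]`. -/
def dataZ1 (t : Fin T → ℝ) (x : ℝ → (Fin n → ℝ)) (y : ℝ → (Fin p → ℝ)) :
    Matrix (Fin n ⊕ Fin p) (Fin T) ℝ :=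
  Matrix.of fun j i => Sum.elim (derivWithin x (Ici 0) (t i)) (y (t i)) j

/-- `(P, Y₁, G₂, α)` is a feasible point of the semidefinite program given by the data
matrices `𝒵₀`, `𝒵₁` and the matrix `R_Q`. In Mathlib, positive (semi)definiteness includes
symmetry of a real matrix. -/
structure SDPFeasible (Z0 : Matrix ((Fin n ⊕ Fin p) ⊕ Fin ℓ) (Fin T) ℝ)
    (Z1 : Matrix (Fin n ⊕ Fin p) (Fin T) ℝ) (RQ : Matrix (Fin n) (Fin τ) ℝ)
    (P : Matrix (Fin n ⊕ Fin p) (Fin n ⊕ Fin p) ℝ)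
    (Y1 : Matrix (Fin T) (Fin n ⊕ Fin p) ℝ) (G2 : Matrix (Fin T) (Fin ℓ) ℝ) (α : ℝ) :
    Prop where
  alpha_pos : 0 < α
  posDef : P.PosDef
  data_Y1 : Z0 * Y1 = fromRows P 0
  lmi : (-(fromBlocks
      (fromBlocks (Z1 * Y1 + (Z1 * Y1)ᵀ + α • 1) (Z1 * G2) (G2ᵀ * Z1ᵀ) (-1))
      (fromRows (P * fromRows RQ 0) 0)
      (fromCols ((fromRows RQ 0)ᵀ * P) 0)
      (-1 : Matrix (Fin τ) (Fin τ) ℝ))).PosSemidef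
  data_G2 : Z0 * G2 = fromRows 0 1
  ones : (Matrix.of fun _ _ => 1 : Matrix (Fin 1) (Fin T) ℝ) * fromCols Y1 G2 = 0

/-- The controller gain `𝒦 = U₀ [Y₁ P⁻¹, G₂]`. -/
def gain (U0 : Matrix (Fin m) (Fin T) ℝ) (P : Matrix (Fin n ⊕ Fin p) (Fin n ⊕ Fin p) ℝ)
    (Y1 : Matrix (Fin T) (Fin n ⊕ Fin p) ℝ) (G2 : Matrix (Fin T) (Fin ℓ) ℝ) :
    Matrix (Fin m) ((Fin n ⊕ Fin p) ⊕ Fin ℓ) ℝ :=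
  U0 * fromCols (Y1 * P⁻¹) G2

/-- `(x, ξ)` is a solution, on the time interval `I`, of the closed-loop system
`ẋ = f(x) + B 𝒦 𝒵(x, ξ) + E d`, `ξ̇ = h(x) - r`. -/
def IsClosedLoopSolution (f : (Fin n → ℝ) → (Fin n → ℝ)) (h : (Fin n → ℝ) → (Fin p → ℝ))
    (B : Matrix (Fin n) (Fin m) ℝ) (E : Matrix (Fin n) (Fin q) ℝ)
    (Q : (Fin n → ℝ) → (Fin ℓ → ℝ)) (K : Matrix (Fin m) ((Fin n ⊕ Fin p) ⊕ Fin ℓ) ℝ)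
    (d : Fin q → ℝ) (r : Fin p → ℝ) (I : Set ℝ)
    (x : ℝ → (Fin n → ℝ)) (ξ : ℝ → (Fin p → ℝ)) : Prop :=
  ∀ t ∈ I,
    HasDerivWithinAt x (f (x t) + B *ᵥ (K *ᵥ extDictionary Q (x t) (ξ t)) + E *ᵥ d) I t ∧
    HasDerivWithinAt ξ (h (x t) - r) I t

end IntegralControl

end

/-! All data columns obey the plant equations with the same unknown term `E dₑ`, so combining them
with weights of zero sum eliminates it. If the weights also reproduce `𝒵(x, ξ)`, the closed loop for
`w = [x; ξ]` becomes `ẇ = F w + G Q(x) + c`, where `F = 𝒵₁ Y₁ P⁻¹` and `G = 𝒵₁ G₂` come from data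
and `d`, `r` enter only through the constant `c` (`closedLoop_eq_closedLoopField`).

The Jacobian bound gives `|Q x - Q y| ≤ |R_Qᵀ (x - y)|`. Inserted into the matrix inequality, it
makes this field strongly dissipative for the inner product of `P⁻¹`, whatever `c` is
(`SDPFeasible.exists_inner_le`). The field is also globally Lipschitz, so solutions are global and
unique, an equilibrium exists, and all trajectories converge to it (`exists_equilibrium_tendsto`).
The `ξ` component of the field is the error `e`, which therefore vanishes at the equilibrium and
tends to zero along every solution. -/

namespace IntegralControl

open scoped NNReal RealInnerProductSpace

variable {n p m q ℓ τ T : ℕ}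

/-! ### Strongly dissipative fields: equilibrium and exponential decay. -/

section Dissipative

variable {H : Type*} [NormedAddCommGroup H] [InnerProductSpace ℝ H]

/-- A Lipschitz strongly dissipative vector field on a Hilbert space has an equilibrium. -/
theorem exists_eq_zero_of_lipschitz_of_inner_le [CompleteSpace H] {v : H → H} {L : ℝ≥0} {c : ℝ}
    (hL : LipschitzWith L v) (hc : 0 < c)
    (hv : ∀ x y, ⟪x - y, v x - v y⟫ ≤ -c * ‖x - y‖ ^ 2) : ∃ z, v z = 0 := by
  -- The squared Lipschitz constant of `x + ε v(x)` is at most `1 - 2εc + ε²L²`. This `ε` makes it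
  -- `1 - εc - (εc)²`, with `εc ≤ 1` and no division by zero when `L = 0`; Banach's fixed point
  -- theorem then applies.
  set ε : ℝ := c / (L ^ 2 + c ^ 2) with hε
  have hpos : (0 : ℝ) < L ^ 2 + c ^ 2 := by positivity
  have hε0 : 0 < ε := by positivity
  have hεL : ε * (L ^ 2 + c ^ 2) = c := by rw [hε]; field_simp
  have hεc : ε * c ≤ 1 := by
    rw [hε, div_mul_eq_mul_div, div_le_one hpos]
    nlinarith [sq_nonneg (L : ℝ)]
  have hcontr : ContractingWith (Real.sqrt (1 - ε * c)).toNNReal (fun x => x + ε • v x) := by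
    refine ⟨?_, LipschitzWith.of_dist_le_mul fun x y => ?_⟩
    · rw [Real.toNNReal_lt_one, Real.sqrt_lt' one_pos]
      nlinarith [mul_pos hε0 hc]
    · rw [Real.coe_toNNReal _ (Real.sqrt_nonneg _), dist_eq_norm, dist_eq_norm]
      refine le_of_sq_le_sq ?_ (by positivity)
      rw [mul_pow, Real.sq_sqrt (by linarith),
        show x + ε • v x - (y + ε • v y) = (x - y) + ε • (v x - v y) by
          rw [smul_sub]; abel,
        norm_add_sq_real, real_inner_smul_right, norm_smul, Real.norm_of_nonneg hε0.le]
      have h1 := hv x y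
      have h2 : ‖v x - v y‖ ≤ L * ‖x - y‖ := hL.norm_sub_le x y
      have h3 : ‖v x - v y‖ ^ 2 ≤ L ^ 2 * ‖x - y‖ ^ 2 := by
        rw [← mul_pow]; gcongr
      have h4 : ε ^ 2 * ‖v x - v y‖ ^ 2 ≤ ε ^ 2 * (L ^ 2 * ‖x - y‖ ^ 2) := by gcongr
      have h5 : ε * ⟪x - y, v x - v y⟫ ≤ ε * (-c * ‖x - y‖ ^ 2) := by gcongr
      have h6 : ε ^ 2 * (L ^ 2 * ‖x - y‖ ^ 2) = ε * c * ‖x - y‖ ^ 2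
          - (ε * c) ^ 2 * ‖x - y‖ ^ 2 := by
        linear_combination ε * ‖x - y‖ ^ 2 * hεL
      nlinarith [sq_nonneg (ε * c * ‖x - y‖)]
  have : Nonempty H := ⟨0⟩
  refine ⟨hcontr.fixedPoint, ?_⟩
  have hfix := hcontr.fixedPoint_isFixedPt
  simpa [Function.IsFixedPt, hε0.ne'] using hfix

/-- A curve whose velocity is strongly dissipative tends to zero exponentially fast. -/
theorem norm_sq_le_exp_of_inner_le {z z' : ℝ → H} {c : ℝ}
    (hz : ∀ t, 0 ≤ t → HasDerivWithinAt z (z' t) (Ici 0) t)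
    (hle : ∀ t, 0 ≤ t → ⟪z t, z' t⟫ ≤ -c * ‖z t‖ ^ 2) {t : ℝ} (ht : 0 ≤ t) :
    ‖z t‖ ^ 2 ≤ ‖z 0‖ ^ 2 * Real.exp (-(2 * c) * t) := by
  -- Grönwall by an integrating factor: `exp (2cs) ‖z s‖²` is nonincreasing.
  have hderiv : ∀ s, 0 ≤ s → HasDerivWithinAt (fun s => Real.exp (2 * c * s) * ‖z s‖ ^ 2)
      (Real.exp (2 * c * s) * (2 * c) * ‖z s‖ ^ 2 + Real.exp (2 * c * s) * (2 * ⟪z s, z' s⟫))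
      (Ici 0) s := fun s hs => by
    have h1 : HasDerivAt (fun s => Real.exp (2 * c * s)) (Real.exp (2 * c * s) * (2 * c)) s := by
      simpa using ((hasDerivAt_id s).const_mul (2 * c)).exp
    exact h1.hasDerivWithinAt.mul (hz s hs).norm_sq
  have hanti : AntitoneOn (fun s => Real.exp (2 * c * s) * ‖z s‖ ^ 2) (Ici 0) := by
    refine antitoneOn_of_hasDerivWithinAt_nonpos (convex_Ici 0)
      (fun s hs => (hderiv s hs).continuousWithinAt)
      (fun s hs => (hderiv s (interior_subset hs)).mono interior_subset) fun s hs => ?_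
    have h1 := hle s (interior_subset hs)
    have h2 := Real.exp_pos (2 * c * s)
    nlinarith [mul_le_mul_of_nonneg_left h1 h2.le]
  have h := hanti (mem_Ici.2 le_rfl) (mem_Ici.2 ht) ht
  simp only [mul_zero, Real.exp_zero, one_mul] at h
  rw [neg_mul, Real.exp_neg, ← div_eq_mul_inv, le_div_iff₀ (Real.exp_pos _), mul_comm]
  exact h

end Dissipative

/-! ### Global existence and forward uniqueness for Lipschitz fields. -/

section GlobalFlow

variable {V : Type*} [NormedAddCommGroup V] [NormedSpace ℝ V]

/-- A globally Lipschitz `C¹` vector field has integral curves defined on the whole line. -/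
theorem exists_hasDerivAt_of_lipschitz [CompleteSpace V] {v : V → V} {L : ℝ≥0}
    (hv : ContDiff ℝ 1 v) (hL : LipschitzWith L v) (x₀ : V) :
    ∃ γ : ℝ → V, γ 0 = x₀ ∧ ∀ t, HasDerivAt γ (v (γ t)) t := by
  have hv' : ContMDiff (modelWithCornersSelf ℝ V) (modelWithCornersSelf ℝ V).tangent 1
      (fun x => (⟨x, v x⟩ : TangentBundle (modelWithCornersSelf ℝ V) V)) :=
    contMDiff_vectorSpace_iff_contDiff.2 hv
  -- This existence time is the same for all starting points, which is what lets local curves be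
  -- glued. On the ball of radius `a = ‖v x‖` about `x` the speed is at most `(L + 1) a`, so the
  -- curve cannot leave it within time `1 / (L + 1)`.
  have hε : (0 : ℝ) < 1 / (L + 1) := by positivity
  obtain ⟨γ, hγ0, hγ⟩ := exists_isMIntegralCurve_of_isMIntegralCurveOn
    (I := modelWithCornersSelf ℝ V) (M := V) (v := v) hv' hε (fun x => by
      let a : ℝ≥0 := ‖v x‖₊
      have hPL : IsPicardLindelof (fun _ => v) (tmin := -(1 / (L + 1))) (tmax := 1 / (L + 1))
          ⟨(0 : ℝ), by constructor <;> linarith⟩ x a 0 (L * a + a) L := by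
        refine .of_time_independent (fun y hy => ?_) hL.lipschitzOnWith ?_
        · have h1 := hL.norm_sub_le y x
          have h2 : ‖y - x‖ ≤ a := by simpa [dist_eq_norm] using hy
          have h3 : ‖v y‖ ≤ ‖v y - v x‖ + ‖v x‖ := norm_le_norm_sub_add _ _
          have h4 : (L : ℝ) * ‖y - x‖ ≤ L * a := by gcongr
          push_cast
          simp only [a, coe_nnnorm] at h4 ⊢
          linarith
        · push_cast
          simp only [sub_zero, zero_sub, neg_neg, max_self]
          apply le_of_eq
          field_simp
      obtain ⟨γ, h0, hγ⟩ := hPL.exists_eq_forall_mem_Icc_hasDerivWithinAt₀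
      refine ⟨γ, h0, fun t ht => ?_⟩
      have := ((hγ t (Ioo_subset_Icc_self ht)).mono Ioo_subset_Icc_self).hasFDerivWithinAt
      exact this.hasMFDerivWithinAt) x₀
  refine ⟨γ, hγ0, fun t => ?_⟩
  have h : HasFDerivAt γ ((1 : ℝ →L[ℝ] ℝ).smulRight (v (γ t))) t :=
    hasMFDerivAt_iff_hasFDerivAt.1 (hγ t)
  simpa using h.hasDerivAt

/-- Forward uniqueness of the integral curves of a globally Lipschitz vector field. -/
theorem eqOn_Ico_of_lipschitz {v : V → V} {L : ℝ≥0} (hL : LipschitzWith L v) {b : ℝ}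
    {γ δ : ℝ → V} (h0 : γ 0 = δ 0)
    (hγ : ∀ t ∈ Ico 0 b, HasDerivWithinAt γ (v (γ t)) (Ico 0 b) t)
    (hδ : ∀ t ∈ Ico 0 b, HasDerivWithinAt δ (v (δ t)) (Ico 0 b) t) :
    EqOn γ δ (Ico 0 b) := by
  intro t ht
  have hsub : Icc 0 t ⊆ Ico 0 b := fun s hs => ⟨hs.1, hs.2.trans_lt ht.2⟩
  have hright : ∀ {η : ℝ → V}, (∀ t ∈ Ico 0 b, HasDerivWithinAt η (v (η t)) (Ico 0 b) t) →
      ∀ s ∈ Ico 0 t, HasDerivWithinAt η (v (η s)) (Ici s) s := fun hη s hs =>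
    (hη s (hsub (Ico_subset_Icc_self hs))).mono_of_mem_nhdsWithin
      (mem_of_superset (Ico_mem_nhdsGE (hs.2.trans ht.2)) (Ico_subset_Ico_left hs.1))
  exact ODE_solution_unique_of_mem_Icc_right (v := fun _ => v) (s := fun _ => univ)
    (fun _ _ => hL.lipschitzOnWith)
    (fun s hs => ((hγ s (hsub hs)).continuousWithinAt).mono hsub) (hright hγ) (fun _ _ => mem_univ _)
    (fun s hs => ((hδ s (hsub hs)).continuousWithinAt).mono hsub) (hright hδ) (fun _ _ => mem_univ _)
    h0 ⟨ht.1, le_rfl⟩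

end GlobalFlow

/-! ### From the Jacobian bound to increments of `Q`. -/

section Jacobian

/-- A uniform bound on the Jacobian in the Loewner order bounds the increments of `Q`. -/
theorem dotProduct_sub_le_of_jacobian_le {Q : (Fin n → ℝ) → (Fin ℓ → ℝ)}
    (hQ : Differentiable ℝ Q) {R : Matrix (Fin n) (Fin τ) ℝ}
    (hR : ∀ x, (R * Rᵀ - (jacobian Q x)ᵀ * jacobian Q x).PosSemidef) (x y : Fin n → ℝ) :
    (Q x - Q y) ⬝ᵥ (Q x - Q y) ≤ (Rᵀ *ᵥ (x - y)) ⬝ᵥ (Rᵀ *ᵥ (x - y)) := by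
  set Δ := x - y with hΔ
  set v := Q x - Q y with hv
  -- The mean value theorem needs a scalar function, so `Q` on the segment is paired with its own
  -- increment `v`. This yields `v ⬝ᵥ w = v ⬝ᵥ v` for `w = J Δ` at an intermediate point, and `0 ≤
  -- |v - w|²` then gives `|v|² ≤ |w|²`.
  have hline : ∀ s : ℝ, HasDerivAt (fun s : ℝ => v ⬝ᵥ Q (y + s • Δ))
      (v ⬝ᵥ (jacobian Q (y + s • Δ) *ᵥ Δ)) s := fun s => by
    have h1 : HasDerivAt (fun s : ℝ => y + s • Δ) Δ s := by
      simpa using ((hasDerivAt_id s).smul_const Δ).const_add y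
    have h2 : HasDerivAt (fun s : ℝ => Q (y + s • Δ)) (jacobian Q (y + s • Δ) *ᵥ Δ) s := by
      have := (hQ (y + s • Δ)).hasFDerivAt.comp_hasDerivAt s h1
      rw [jacobian, LinearMap.toMatrix'_mulVec]
      exact this
    simp only [dotProduct]
    exact HasDerivAt.fun_sum fun i _ => ((hasDerivAt_pi.1 h2) i).const_mul (v i)
  obtain ⟨s, -, hs⟩ := exists_hasDerivAt_eq_slope (fun s : ℝ => v ⬝ᵥ Q (y + s • Δ))
    (fun s => v ⬝ᵥ (jacobian Q (y + s • Δ) *ᵥ Δ)) zero_lt_one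
    (fun s _ => (hline s).continuousAt.continuousWithinAt) (fun s _ => hline s)
  set w := jacobian Q (y + s • Δ) *ᵥ Δ with hw
  have hvw : v ⬝ᵥ w = v ⬝ᵥ v := by
    rw [hs]
    simp [hΔ, ← dotProduct_sub, ← hv]
  have hsq : 0 ≤ (v - w) ⬝ᵥ (v - w) := by
    simpa using dotProduct_star_self_nonneg (v - w)
  have hww : v ⬝ᵥ v ≤ w ⬝ᵥ w := by
    rw [sub_dotProduct, dotProduct_sub v v w, dotProduct_sub w v w, dotProduct_comm w v, hvw] at hsq
    linarith
  have hJ := (hR (y + s • Δ)).dotProduct_mulVec_nonneg Δ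
  rw [star_trivial, sub_mulVec, dotProduct_sub, ← mulVec_mulVec, ← mulVec_mulVec,
    dotProduct_mulVec, dotProduct_mulVec Δ (jacobian Q (y + s • Δ))ᵀ, vecMul_transpose,
    ← mulVec_transpose, ← hw] at hJ
  linarith

/-- A uniform bound on the Jacobian in the Loewner order makes `Q` globally Lipschitz. -/
theorem exists_lipschitzWith_of_jacobian_le {Q : (Fin n → ℝ) → (Fin ℓ → ℝ)}
    (hQ : Differentiable ℝ Q) {R : Matrix (Fin n) (Fin τ) ℝ}
    (hR : ∀ x, (R * Rᵀ - (jacobian Q x)ᵀ * jacobian Q x).PosSemidef) :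
    ∃ L : ℝ≥0, LipschitzWith L Q := by
  -- The increment bound is Euclidean while `Fin n → ℝ` carries the sup norm; the operator norm of
  -- `φ` absorbs the change.
  let φ : (Fin n → ℝ) →L[ℝ] EuclideanSpace ℝ (Fin τ) :=
    ((EuclideanSpace.equiv (Fin τ) ℝ).symm : (Fin τ → ℝ) →L[ℝ] EuclideanSpace ℝ (Fin τ)).comp
      (LinearMap.toContinuousLinearMap Rᵀ.mulVecLin)
  have hnorm : ∀ {k : ℕ} (v : Fin k → ℝ), ‖(WithLp.toLp 2 v : EuclideanSpace ℝ (Fin k))‖ ^ 2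
      = v ⬝ᵥ v := fun v => by
    rw [EuclideanSpace.real_norm_sq_eq]
    simp only [dotProduct, sq]
  refine ⟨‖φ‖₊, LipschitzWith.of_dist_le_mul fun x y => ?_⟩
  rw [dist_eq_norm, dist_eq_norm]
  have h1 : ‖(WithLp.toLp 2 (Q x - Q y) : EuclideanSpace ℝ (Fin ℓ))‖ ≤ ‖φ (x - y)‖ := by
    refine le_of_sq_le_sq ?_ (norm_nonneg _)
    have h := dotProduct_sub_le_of_jacobian_le hQ hR x y
    rw [← hnorm, ← hnorm] at h
    exact h
  have h2 : ‖Q x - Q y‖ ≤ ‖(WithLp.toLp 2 (Q x - Q y) : EuclideanSpace ℝ (Fin ℓ))‖ :=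
    (pi_norm_le_iff_of_nonneg (norm_nonneg _)).2 fun i =>
      PiLp.norm_apply_le (WithLp.toLp 2 (Q x - Q y) : EuclideanSpace ℝ (Fin ℓ)) i
  exact h2.trans (h1.trans (φ.le_opNorm _))

end Jacobian

/-! ### Regularity of the closed-loop field. -/

section ClosedLoop

/-- The vector field `F w + G Q(x) + c`, where `x` is the first block of `w = [x; ξ]`. -/
def closedLoopField (Q : (Fin n → ℝ) → (Fin ℓ → ℝ)) (F : Matrix (Fin n ⊕ Fin p) (Fin n ⊕ Fin p) ℝ)
    (G : Matrix (Fin n ⊕ Fin p) (Fin ℓ) ℝ) (c w : Fin n ⊕ Fin p → ℝ) : Fin n ⊕ Fin p → ℝ :=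
  F *ᵥ w + G *ᵥ Q (w ∘ Sum.inl) + c

theorem contDiff_closedLoopField {Q : (Fin n → ℝ) → (Fin ℓ → ℝ)} (hQ : ContDiff ℝ 1 Q)
    (F : Matrix (Fin n ⊕ Fin p) (Fin n ⊕ Fin p) ℝ)
    (G : Matrix (Fin n ⊕ Fin p) (Fin ℓ) ℝ) (c : Fin n ⊕ Fin p → ℝ) :
    ContDiff ℝ 1 (closedLoopField Q F G c) := by
  have h1 : ContDiff ℝ 1 fun w : Fin n ⊕ Fin p → ℝ => w ∘ Sum.inl :=
    contDiff_pi.2 fun i => contDiff_apply ℝ ℝ (Sum.inl i)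
  exact ((LinearMap.toContinuousLinearMap F.mulVecLin).contDiff.add
    ((LinearMap.toContinuousLinearMap G.mulVecLin).contDiff.comp (hQ.comp h1))).add contDiff_const

theorem exists_lipschitzWith_closedLoopField {Q : (Fin n → ℝ) → (Fin ℓ → ℝ)} {L : ℝ≥0}
    (hQ : LipschitzWith L Q) (F : Matrix (Fin n ⊕ Fin p) (Fin n ⊕ Fin p) ℝ)
    (G : Matrix (Fin n ⊕ Fin p) (Fin ℓ) ℝ) (c : Fin n ⊕ Fin p → ℝ) :
    ∃ K : ℝ≥0, LipschitzWith K (closedLoopField Q F G c) := by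
  have h1 : LipschitzWith 1 fun w : Fin n ⊕ Fin p → ℝ => w ∘ Sum.inl :=
    LipschitzWith.of_dist_le_mul fun x y => by
      rw [NNReal.coe_one, one_mul]
      exact (dist_pi_le_iff dist_nonneg).2 fun i => dist_le_pi_dist x y (Sum.inl i)
  exact ⟨_, ((LinearMap.toContinuousLinearMap F.mulVecLin).lipschitz.add
    ((LinearMap.toContinuousLinearMap G.mulVecLin).lipschitz.comp (hQ.comp h1))).add
      (LipschitzWith.const c)⟩

end ClosedLoop

/-! ### The quadratic form of the matrix inequality. -/

section LMI

/-- The quadratic form of the linear matrix inequality, evaluated at `(a, v, R_Qᵀ x)`, where `x` is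
the state part of `P a`. -/
theorem SDPFeasible.dotProduct_le {Z0 : Matrix ((Fin n ⊕ Fin p) ⊕ Fin ℓ) (Fin T) ℝ}
    {Z1 : Matrix (Fin n ⊕ Fin p) (Fin T) ℝ} {RQ : Matrix (Fin n) (Fin τ) ℝ}
    {P : Matrix (Fin n ⊕ Fin p) (Fin n ⊕ Fin p) ℝ}
    {Y1 : Matrix (Fin T) (Fin n ⊕ Fin p) ℝ} {G2 : Matrix (Fin T) (Fin ℓ) ℝ} {α : ℝ}
    (h : SDPFeasible Z0 Z1 RQ P Y1 G2 α) (a : Fin n ⊕ Fin p → ℝ) (v : Fin ℓ → ℝ)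
    (hv : v ⬝ᵥ v ≤ (RQᵀ *ᵥ ((P *ᵥ a) ∘ Sum.inl)) ⬝ᵥ (RQᵀ *ᵥ ((P *ᵥ a) ∘ Sum.inl))) :
    a ⬝ᵥ ((Z1 * Y1) *ᵥ a + (Z1 * G2) *ᵥ v) ≤ -(α / 2) * (a ⬝ᵥ a) := by
  set c := RQᵀ *ᵥ ((P *ᵥ a) ∘ Sum.inl) with hc
  have hPs : Pᵀ = P := by simpa using h.posDef.isHermitian.eq
  let N : Matrix (Fin n ⊕ Fin p) (Fin τ) ℝ := fromRows RQ 0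
  have hlmi : (-(fromBlocks
      (fromBlocks (Z1 * Y1 + (Z1 * Y1)ᵀ + α • 1) (Z1 * G2) (G2ᵀ * Z1ᵀ) (-1))
      (fromRows (P * N) 0) (fromCols (Nᵀ * P) 0)
      (-1 : Matrix (Fin τ) (Fin τ) ℝ))).PosSemidef := h.lmi
  have hRP : (Nᵀ * P) *ᵥ a = c := by
    rw [← mulVec_mulVec, transpose_fromRows, transpose_zero, hc]
    nth_rw 1 [← Sum.elim_comp_inl_inr (P *ᵥ a)]
    rw [fromCols_mulVec_sumElim, zero_mulVec, add_zero]
  have hPR : a ⬝ᵥ (P * N) *ᵥ c = c ⬝ᵥ c := by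
    rw [dotProduct_mulVec, ← mulVec_transpose, transpose_mul, hPs, hRP]
  -- The third block contributes `2 c ⬝ᵥ c' - c' ⬝ᵥ c'` at `c'`, largest at `c' = c`, as in a Schur
  -- complement. The resulting `|c|²` dominates `|v|²` by `hv`.
  have hq := hlmi.dotProduct_mulVec_nonneg (Sum.elim (Sum.elim a v) c)
  have hG : v ⬝ᵥ (G2ᵀ * Z1ᵀ) *ᵥ a = a ⬝ᵥ (Z1 * G2) *ᵥ v := by
    rw [← transpose_mul, dotProduct_mulVec, vecMul_transpose, dotProduct_comm]
  have hY : a ⬝ᵥ (Z1 * Y1)ᵀ *ᵥ a = a ⬝ᵥ (Z1 * Y1) *ᵥ a := by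
    rw [dotProduct_mulVec, vecMul_transpose, dotProduct_comm]
  rw [star_trivial, neg_mulVec, fromBlocks_mulVec, Sum.elim_comp_inl, Sum.elim_comp_inr,
    fromBlocks_mulVec, Sum.elim_comp_inl, Sum.elim_comp_inr, fromRows_mulVec,
    fromCols_mulVec_sumElim, dotProduct_neg, sumElim_dotProduct_sumElim, hRP] at hq
  simp only [← Sum.elim_add_add, sumElim_dotProduct_sumElim, zero_mulVec, add_zero, add_mulVec,
    dotProduct_add, neg_mulVec, one_mulVec, dotProduct_neg, smul_mulVec, dotProduct_smul,
    smul_eq_mul, hPR, hG, hY] at hq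
  rw [dotProduct_add]
  linarith

end LMI

/-! ### Eliminating the model by means of data. -/

section DataRepresentation

/-- Combining the data columns with weights of zero sum that reproduce `𝒵(x, ξ)` yields the plant
equations at `x`, free of the disturbance and of the reference of the experiment. -/
theorem IsExperiment.dataZ1_mulVec {f : (Fin n → ℝ) → (Fin n → ℝ)} {h : (Fin n → ℝ) → (Fin p → ℝ)}
    {B : Matrix (Fin n) (Fin m) ℝ} {E : Matrix (Fin n) (Fin q) ℝ}
    {Q : (Fin n → ℝ) → (Fin ℓ → ℝ)}
    {A : Matrix (Fin n) (Fin n ⊕ Fin ℓ) ℝ} {C : Matrix (Fin p) (Fin n ⊕ Fin ℓ) ℝ}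
    (hf : ∀ x, f x = A *ᵥ dictionary Q x) (hh : ∀ x, h x = C *ᵥ dictionary Q x)
    {d : Fin q → ℝ} {r : Fin p → ℝ} {ts : Fin T → ℝ}
    {xₑ : ℝ → (Fin n → ℝ)} {ξₑ : ℝ → (Fin p → ℝ)} {u : ℝ → (Fin m → ℝ)} {y : ℝ → (Fin p → ℝ)}
    (hexp : IsExperiment f h B E d r ts xₑ ξₑ u y) {g : Fin T → ℝ} (hg : ∑ i, g i = 0)
    {x : Fin n → ℝ} {ξ : Fin p → ℝ} (hZ : dataZ0 Q ts xₑ ξₑ *ᵥ g = extDictionary Q x ξ) :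
    dataZ1 ts xₑ y *ᵥ g = Sum.elim (f x + B *ᵥ (dataU0 ts u *ᵥ g)) (h x) := by
  have hdict : ∑ i, g i • dictionary Q (xₑ (ts i)) = dictionary Q x := by
    ext (k | k)
    · have := congrFun hZ (Sum.inl (Sum.inl k))
      simpa [mulVec, dotProduct, dataZ0, extDictionary, dictionary, mul_comm] using this
    · have := congrFun hZ (Sum.inr k)
      simpa [mulVec, dotProduct, dataZ0, extDictionary, dictionary, mul_comm] using this
  have hU : dataU0 ts u *ᵥ g = ∑ i, g i • u (ts i) := by
    ext k
    simp [mulVec, dotProduct, dataU0, mul_comm]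
  have hderiv : ∀ i, derivWithin xₑ (Ici 0) (ts i) =
      f (xₑ (ts i)) + B *ᵥ u (ts i) + E *ᵥ d := fun i =>
    (hexp.state_eq i).derivWithin (uniqueDiffOn_Ici 0 _ (hexp.times_nonneg i))
  -- The zero sum cancels `E d`. The reference needs no cancellation, since `𝒵₁` stores `y` and not
  -- `y - r`.
  have hstate : ∑ i, g i • derivWithin xₑ (Ici 0) (ts i) = f x + B *ᵥ (dataU0 ts u *ᵥ g) := by
    simp only [hderiv, hf, smul_add, Finset.sum_add_distrib, ← Finset.sum_smul, hg, zero_smul,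
      ← mulVec_smul, ← mulVec_sum, hdict, hU, mulVec_zero, add_zero]
  have hout : ∑ i, g i • y (ts i) = h x := by
    simp only [hexp.output_eq, hh, ← mulVec_smul, ← mulVec_sum, hdict]
  ext (k | k)
  · rw [Sum.elim_inl, ← hstate]
    simp [mulVec, dotProduct, dataZ1, mul_comm]
  · rw [Sum.elim_inr, ← hout]
    simp [mulVec, dotProduct, dataZ1, mul_comm]

/-- Data-based representation of the closed loop. -/
theorem closedLoop_eq_closedLoopField {f : (Fin n → ℝ) → (Fin n → ℝ)}
    {h : (Fin n → ℝ) → (Fin p → ℝ)}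
    {B : Matrix (Fin n) (Fin m) ℝ} {E : Matrix (Fin n) (Fin q) ℝ}
    {Q : (Fin n → ℝ) → (Fin ℓ → ℝ)}
    {A : Matrix (Fin n) (Fin n ⊕ Fin ℓ) ℝ} {C : Matrix (Fin p) (Fin n ⊕ Fin ℓ) ℝ}
    (hf : ∀ x, f x = A *ᵥ dictionary Q x) (hh : ∀ x, h x = C *ᵥ dictionary Q x)
    {dₑ : Fin q → ℝ} {rₑ : Fin p → ℝ} {ts : Fin T → ℝ}
    {xₑ : ℝ → (Fin n → ℝ)} {ξₑ : ℝ → (Fin p → ℝ)} {u : ℝ → (Fin m → ℝ)} {y : ℝ → (Fin p → ℝ)}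
    (hexp : IsExperiment f h B E dₑ rₑ ts xₑ ξₑ u y) {RQ : Matrix (Fin n) (Fin τ) ℝ}
    {P : Matrix (Fin n ⊕ Fin p) (Fin n ⊕ Fin p) ℝ}
    {Y1 : Matrix (Fin T) (Fin n ⊕ Fin p) ℝ} {G2 : Matrix (Fin T) (Fin ℓ) ℝ} {α : ℝ}
    (hSDP : SDPFeasible (dataZ0 Q ts xₑ ξₑ) (dataZ1 ts xₑ y) RQ P Y1 G2 α)
    (d : Fin q → ℝ) (r : Fin p → ℝ) (x : Fin n → ℝ) (ξ : Fin p → ℝ) :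
    Sum.elim (f x + B *ᵥ (gain (dataU0 ts u) P Y1 G2 *ᵥ extDictionary Q x ξ) + E *ᵥ d) (h x - r) =
      closedLoopField Q (dataZ1 ts xₑ y * (Y1 * P⁻¹)) (dataZ1 ts xₑ y * G2)
        (Sum.elim (E *ᵥ d) (-r)) (Sum.elim x ξ) := by
  -- These weights serve twice: `𝒵₀ g = 𝒵(x, ξ)` by the equality constraints, and `U₀ g = 𝒦 𝒵(x, ξ)`
  -- by the definition of the gain.
  set g : Fin T → ℝ := fromCols (Y1 * P⁻¹) G2 *ᵥ extDictionary Q x ξ with hg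
  have hg' : g = Y1 *ᵥ (P⁻¹ *ᵥ Sum.elim x ξ) + G2 *ᵥ Q x := by
    rw [hg, extDictionary, fromCols_mulVec_sumElim, mulVec_mulVec]
  have hPP : P * P⁻¹ = 1 := mul_nonsing_inv _ (P.isUnit_iff_isUnit_det.1 hSDP.posDef.isUnit)
  have hZ : dataZ0 Q ts xₑ ξₑ *ᵥ g = extDictionary Q x ξ := by
    rw [hg', mulVec_add, mulVec_mulVec, mulVec_mulVec (Q x), hSDP.data_Y1, hSDP.data_G2,
      fromRows_mulVec, fromRows_mulVec, mulVec_mulVec, hPP, one_mulVec, one_mulVec, zero_mulVec,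
      zero_mulVec, ← Sum.elim_add_add, add_zero, zero_add, extDictionary]
  have hsum : ∑ i, g i = 0 := by
    have h1 := hSDP.ones
    rw [mul_fromCols, ← fromCols_zero, fromCols_ext_iff] at h1
    have hone : ∀ v : Fin T → ℝ, ∑ i, v i =
        ((Matrix.of fun _ _ => 1 : Matrix (Fin 1) (Fin T) ℝ) *ᵥ v) 0 := fun v => by
      simp [mulVec, dotProduct]
    rw [hone, hg', mulVec_add, mulVec_mulVec, mulVec_mulVec (Q x), h1.1, h1.2]
    simp
  have hmain := hexp.dataZ1_mulVec hf hh hsum hZ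
  have hK : gain (dataU0 ts u) P Y1 G2 *ᵥ extDictionary Q x ξ = dataU0 ts u *ᵥ g := by
    rw [gain, ← mulVec_mulVec]
  have hfield : dataZ1 ts xₑ y *ᵥ g = (dataZ1 ts xₑ y * (Y1 * P⁻¹)) *ᵥ Sum.elim x ξ +
      (dataZ1 ts xₑ y * G2) *ᵥ Q x := by
    rw [hg', mulVec_add]
    simp only [mulVec_mulVec]
  rw [closedLoopField, Sum.elim_comp_inl, ← hfield, hmain, hK, ← Sum.elim_add_add,
    ← sub_eq_add_neg]

end DataRepresentation

/-! ### Dissipativity in the metric of `P⁻¹`. -/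

section Contraction

open scoped MatrixOrder Matrix.Norms.L2Operator in
/-- A positive definite matrix is the Gram matrix of a linear isomorphism to Euclidean space. -/
theorem exists_continuousLinearEquiv_inner_eq {ι : Type*} [Fintype ι] [DecidableEq ι]
    {M : Matrix ι ι ℝ} (hM : M.PosDef) :
    ∃ e : (ι → ℝ) ≃L[ℝ] EuclideanSpace ℝ ι, ∀ a b, ⟪e a, e b⟫ = a ⬝ᵥ M *ᵥ b := by
  obtain ⟨S, hS⟩ := CStarAlgebra.nonneg_iff_eq_star_mul_self.mp hM.posSemidef.nonneg
  have hdet : IsUnit S.det := by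
    have h1 := M.isUnit_iff_isUnit_det.1 hM.isUnit
    rw [hS, det_mul] at h1
    exact isUnit_of_mul_isUnit_right h1
  refine ⟨(S.toLinearEquiv' ((S.isUnit_iff_isUnit_det.2 hdet).invertible)).toContinuousLinearEquiv.trans
    (EuclideanSpace.equiv ι ℝ).symm, fun a b => ?_⟩
  have h1 : ∀ v, (S.toLinearEquiv' ((S.isUnit_iff_isUnit_det.2 hdet).invertible)) v = S *ᵥ v :=
    fun v => by simp [toLinearEquiv']
  have h2 : ⟪(WithLp.toLp 2 (S *ᵥ a) : EuclideanSpace ℝ ι), WithLp.toLp 2 (S *ᵥ b)⟫ =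
      (S *ᵥ a) ⬝ᵥ (S *ᵥ b) := by
    rw [EuclideanSpace.inner_toLp_toLp, star_trivial, dotProduct_comm]
  have h3 : M = Sᵀ * S := by rw [hS, star_eq_conjTranspose, conjTranspose_eq_transpose_of_trivial]
  rw [h3, ← mulVec_mulVec, dotProduct_mulVec, vecMul_transpose, ← h2, ← h1, ← h1]
  rfl

/-- Feasibility of the semidefinite program makes the closed loop strongly dissipative with respect
to the inner product given by `P⁻¹`. -/
theorem SDPFeasible.exists_inner_le {Q : (Fin n → ℝ) → (Fin ℓ → ℝ)} (hQ : Differentiable ℝ Q)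
    {Z0 : Matrix ((Fin n ⊕ Fin p) ⊕ Fin ℓ) (Fin T) ℝ}
    {Z1 : Matrix (Fin n ⊕ Fin p) (Fin T) ℝ} {RQ : Matrix (Fin n) (Fin τ) ℝ}
    (hRQ : ∀ x, (RQ * RQᵀ - (jacobian Q x)ᵀ * jacobian Q x).PosSemidef)
    {P : Matrix (Fin n ⊕ Fin p) (Fin n ⊕ Fin p) ℝ}
    {Y1 : Matrix (Fin T) (Fin n ⊕ Fin p) ℝ} {G2 : Matrix (Fin T) (Fin ℓ) ℝ} {α : ℝ}
    (h : SDPFeasible Z0 Z1 RQ P Y1 G2 α) (c : Fin n ⊕ Fin p → ℝ) :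
    ∃ (e : (Fin n ⊕ Fin p → ℝ) ≃L[ℝ] EuclideanSpace ℝ (Fin n ⊕ Fin p)) (κ : ℝ), 0 < κ ∧
      ∀ w w', ⟪e (w - w'), e (closedLoopField Q (Z1 * (Y1 * P⁻¹)) (Z1 * G2) c w -
        closedLoopField Q (Z1 * (Y1 * P⁻¹)) (Z1 * G2) c w')⟫ ≤ -κ * ‖e (w - w')‖ ^ 2 := by
  obtain ⟨e, he⟩ := exists_continuousLinearEquiv_inner_eq h.posDef.inv
  have hPP : P * P⁻¹ = 1 := mul_nonsing_inv _ (P.isUnit_iff_isUnit_det.1 h.posDef.isUnit)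
  have hPs : P⁻¹ᵀ = P⁻¹ := by simpa using h.posDef.inv.isHermitian.eq
  let φ : EuclideanSpace ℝ (Fin n ⊕ Fin p) →L[ℝ] EuclideanSpace ℝ (Fin n ⊕ Fin p) :=
    (e : (Fin n ⊕ Fin p → ℝ) →L[ℝ] EuclideanSpace ℝ (Fin n ⊕ Fin p)).comp
      ((LinearMap.toContinuousLinearMap P.mulVecLin).comp
        (EuclideanSpace.equiv (Fin n ⊕ Fin p) ℝ :
          EuclideanSpace ℝ (Fin n ⊕ Fin p) →L[ℝ] (Fin n ⊕ Fin p → ℝ)))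
  -- Turns decay measured by `a ⬝ᵥ a` into decay in the norm of `e`. The `+ 1` keeps the denominator
  -- of the rate positive even if `φ = 0`.
  have hφ : ∀ a, ‖e (P *ᵥ a)‖ ^ 2 ≤ (‖φ‖ ^ 2 + 1) * (a ⬝ᵥ a) := fun a => by
    have h1 : ‖e (P *ᵥ a)‖ ≤ ‖φ‖ * ‖(WithLp.toLp 2 a : EuclideanSpace ℝ (Fin n ⊕ Fin p))‖ :=
      φ.le_opNorm (WithLp.toLp 2 a)
    have h2 : ‖(WithLp.toLp 2 a : EuclideanSpace ℝ (Fin n ⊕ Fin p))‖ ^ 2 = a ⬝ᵥ a := by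
      rw [EuclideanSpace.real_norm_sq_eq]
      simp only [dotProduct, sq]
    calc ‖e (P *ᵥ a)‖ ^ 2 ≤ (‖φ‖ * ‖(WithLp.toLp 2 a : EuclideanSpace ℝ (Fin n ⊕ Fin p))‖) ^ 2 := by
          gcongr
      _ ≤ (‖φ‖ ^ 2 + 1) * (a ⬝ᵥ a) := by
          rw [mul_pow, ← h2]
          gcongr
          linarith
  have hα := h.alpha_pos
  refine ⟨e, α / 2 / (‖φ‖ ^ 2 + 1), by positivity, fun w w' => ?_⟩
  -- With this `a`, the `P⁻¹` inner product of `w - w'` with any vector is the plain dot product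
  -- with `a`, the form that the matrix inequality controls.
  set a := P⁻¹ *ᵥ (w - w') with ha
  have hPa : P *ᵥ a = w - w' := by rw [ha, mulVec_mulVec, hPP, one_mulVec]
  have hincr : closedLoopField Q (Z1 * (Y1 * P⁻¹)) (Z1 * G2) c w -
      closedLoopField Q (Z1 * (Y1 * P⁻¹)) (Z1 * G2) c w' =
      (Z1 * Y1) *ᵥ a + (Z1 * G2) *ᵥ (Q (w ∘ Sum.inl) - Q (w' ∘ Sum.inl)) := by
    rw [ha, mulVec_mulVec, Matrix.mul_assoc, mulVec_sub, mulVec_sub, closedLoopField,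
      closedLoopField]
    abel
  have hle := h.dotProduct_le a (Q (w ∘ Sum.inl) - Q (w' ∘ Sum.inl)) (by
    rw [hPa]
    exact dotProduct_sub_le_of_jacobian_le hQ hRQ _ _)
  rw [he, hincr, dotProduct_mulVec, ← mulVec_transpose, hPs, ← ha]
  refine hle.trans ?_
  have h1 := hφ a
  rw [hPa] at h1
  rw [neg_mul, neg_mul, neg_le_neg_iff, div_mul_eq_mul_div, div_le_iff₀ (by positivity)]
  calc α / 2 * ‖e (w - w')‖ ^ 2 ≤ α / 2 * ((‖φ‖ ^ 2 + 1) * (a ⬝ᵥ a)) := by gcongr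
    _ = _ := by ring

end Contraction

/-! ### Convergence of trajectories to the equilibrium. -/

section Trajectories

variable {V H : Type*} [NormedAddCommGroup V] [NormedSpace ℝ V]
  [NormedAddCommGroup H] [InnerProductSpace ℝ H]

/-- A Lipschitz vector field that is strongly dissipative in some Hilbertian coordinates has an
equilibrium to which all its forward trajectories converge. -/
theorem exists_equilibrium_tendsto [CompleteSpace H] {v : V → V} {L : ℝ≥0} (hL : LipschitzWith L v)
    (e : V ≃L[ℝ] H) {κ : ℝ} (hκ : 0 < κ)
    (hv : ∀ x y, ⟪e (x - y), e (v x - v y)⟫ ≤ -κ * ‖e (x - y)‖ ^ 2) :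
    ∃ z, v z = 0 ∧ ∀ γ : ℝ → V, (∀ t ∈ Ici (0 : ℝ), HasDerivWithinAt γ (v (γ t)) (Ici 0) t) →
      (∃ M, ∀ t, 0 ≤ t → ‖γ t‖ ≤ M) ∧ Tendsto γ atTop (𝓝 z) := by
  -- The field is conjugated by `e`, so `z` lives in `H` and the equilibrium is `e.symm z`.
  obtain ⟨z, hz⟩ := exists_eq_zero_of_lipschitz_of_inner_le (v := fun x => e (v (e.symm x)))
    ((e.lipschitz.comp hL).comp e.symm.lipschitz) hκ (fun x y => by
      simpa [map_sub] using hv (e.symm x) (e.symm y))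
  have hz0 : v (e.symm z) = 0 := by simpa using hz
  refine ⟨e.symm z, hz0, fun γ hγ => ?_⟩
  have hdecay : ∀ t, 0 ≤ t → ‖e (γ t - e.symm z)‖ ^ 2 ≤
      ‖e (γ 0 - e.symm z)‖ ^ 2 * Real.exp (-(2 * κ) * t) := fun t ht =>
    norm_sq_le_exp_of_inner_le (z := fun t => e (γ t - e.symm z)) (z' := fun t => e (v (γ t)))
      (fun t ht => (e : V →L[ℝ] H).hasFDerivAt.comp_hasDerivWithinAt t ((hγ t ht).sub_const _))
      (fun t _ => by simpa [hz0] using hv (γ t) (e.symm z)) ht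
  have hγe : ∀ t, γ t = e.symm (e (γ t - e.symm z)) + e.symm z := fun t => by simp
  constructor
  · refine ⟨‖(e.symm : H →L[ℝ] V)‖ * ‖e (γ 0 - e.symm z)‖ + ‖e.symm z‖, fun t ht => ?_⟩
    have h1 : ‖e (γ t - e.symm z)‖ ≤ ‖e (γ 0 - e.symm z)‖ := by
      refine le_of_sq_le_sq ((hdecay t ht).trans ?_) (norm_nonneg _)
      refine mul_le_of_le_one_right (by positivity) (Real.exp_le_one_iff.2 ?_)
      nlinarith [mul_nonneg hκ.le ht]
    rw [hγe t]
    refine (norm_add_le _ _).trans ?_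
    gcongr
    exact ((e.symm : H →L[ℝ] V).le_opNorm _).trans (by gcongr)
  · have hexp : Tendsto (fun t => ‖e (γ 0 - e.symm z)‖ ^ 2 * Real.exp (-(2 * κ) * t)) atTop
        (𝓝 0) := by
      have h1 : Tendsto (fun t : ℝ => -(2 * κ) * t) atTop atBot :=
        tendsto_id.const_mul_atTop_of_neg (by linarith)
      simpa using (Real.tendsto_exp_atBot.comp h1).const_mul (‖e (γ 0 - e.symm z)‖ ^ 2)
    have hsq : Tendsto (fun t => ‖e (γ t - e.symm z)‖ ^ 2) atTop (𝓝 0) :=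
      tendsto_of_tendsto_of_tendsto_of_le_of_le' tendsto_const_nhds hexp
        (Eventually.of_forall fun t => sq_nonneg _)
        ((eventually_ge_atTop 0).mono fun t ht => hdecay t ht)
    have hnorm : Tendsto (fun t => e (γ t - e.symm z)) atTop (𝓝 0) := by
      rw [tendsto_zero_iff_norm_tendsto_zero]
      simpa [Real.sqrt_sq (norm_nonneg _)] using hsq.sqrt
    have := ((e.symm.continuous.tendsto 0).comp hnorm).add_const (e.symm z)
    rw [map_zero, zero_add] at this
    exact this.congr fun t => (hγe t).symm

end Trajectories

/-- Stacking the two blocks of a closed-loop solution gives an integral curve. -/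
theorem isClosedLoopSolution_iff {f : (Fin n → ℝ) → (Fin n → ℝ)} {h : (Fin n → ℝ) → (Fin p → ℝ)}
    {B : Matrix (Fin n) (Fin m) ℝ} {E : Matrix (Fin n) (Fin q) ℝ}
    {Q : (Fin n → ℝ) → (Fin ℓ → ℝ)} {K : Matrix (Fin m) ((Fin n ⊕ Fin p) ⊕ Fin ℓ) ℝ}
    {d : Fin q → ℝ} {r : Fin p → ℝ} {v : (Fin n ⊕ Fin p → ℝ) → (Fin n ⊕ Fin p → ℝ)}
    (hv : ∀ x ξ, Sum.elim (f x + B *ᵥ (K *ᵥ extDictionary Q x ξ) + E *ᵥ d) (h x - r) =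
      v (Sum.elim x ξ)) {I : Set ℝ} {x : ℝ → (Fin n → ℝ)} {ξ : ℝ → (Fin p → ℝ)} :
    IsClosedLoopSolution f h B E Q K d r I x ξ ↔ ∀ t ∈ I,
      HasDerivWithinAt (fun t => Sum.elim (x t) (ξ t)) (v (Sum.elim (x t) (ξ t))) I t := by
  refine forall₂_congr fun t _ => ?_
  rw [← hv, hasDerivWithinAt_pi, hasDerivWithinAt_pi, hasDerivWithinAt_pi, Sum.forall]
  rfl

end IntegralControl

theorem corollary4 {n p m q ℓ τ T : ℕ}
    -- the plant: `ẋ = f(x) + B u + E d`, `y = h(x)`, with `f = A Z`, `h = C Z`, `Z = [x; Q]`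
    (f : (Fin n → ℝ) → (Fin n → ℝ)) (h : (Fin n → ℝ) → (Fin p → ℝ))
    (B : Matrix (Fin n) (Fin m) ℝ) (E : Matrix (Fin n) (Fin q) ℝ)
    (Q : (Fin n → ℝ) → (Fin ℓ → ℝ)) (hQ : ContDiff ℝ 1 Q)
    (A : Matrix (Fin n) (Fin n ⊕ Fin ℓ) ℝ) (C : Matrix (Fin p) (Fin n ⊕ Fin ℓ) ℝ)
    (hf : ∀ x, f x = A *ᵥ IntegralControl.dictionary Q x)
    (hh : ∀ x, h x = C *ᵥ IntegralControl.dictionary Q x)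
    -- the bound on the Jacobian of `Q`, on the whole space
    (RQ : Matrix (Fin n) (Fin τ) ℝ)
    (hRQ : ∀ x, (RQ * RQᵀ -
      (IntegralControl.jacobian Q x)ᵀ * IntegralControl.jacobian Q x).PosSemidef)
    -- the experiment, with its own constant disturbance `dₑ` and reference `rₑ`
    (dₑ : Fin q → ℝ) (rₑ : Fin p → ℝ) (ts : Fin T → ℝ)
    (xₑ : ℝ → (Fin n → ℝ)) (ξₑ : ℝ → (Fin p → ℝ))
    (uₑ : ℝ → (Fin m → ℝ)) (yₑ : ℝ → (Fin p → ℝ))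
    (hexp : IntegralControl.IsExperiment f h B E dₑ rₑ ts xₑ ξₑ uₑ yₑ)
    -- a feasible point of the semidefinite program
    (P : Matrix (Fin n ⊕ Fin p) (Fin n ⊕ Fin p) ℝ)
    (Y1 : Matrix (Fin T) (Fin n ⊕ Fin p) ℝ) (G2 : Matrix (Fin T) (Fin ℓ) ℝ) (α : ℝ)
    (hSDP : IntegralControl.SDPFeasible (IntegralControl.dataZ0 Q ts xₑ ξₑ)
      (IntegralControl.dataZ1 ts xₑ yₑ) RQ P Y1 G2 α)
    -- the resulting controller gain
    (K : Matrix (Fin m) ((Fin n ⊕ Fin p) ⊕ Fin ℓ) ℝ)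
    (hK : K = IntegralControl.gain (IntegralControl.dataU0 ts uₑ) P Y1 G2)
    -- the constant disturbance and reference acting on the closed loop
    (d : Fin q → ℝ) (r : Fin p → ℝ) :
    -- from every initial state there is a solution on `[0, ∞)`, and every solution on some
    -- `[0, b)` from that initial state is a restriction of it
    (∀ (x₀ : Fin n → ℝ) (ξ₀ : Fin p → ℝ),
      ∃ (x : ℝ → (Fin n → ℝ)) (ξ : ℝ → (Fin p → ℝ)),
        x 0 = x₀ ∧ ξ 0 = ξ₀ ∧
        IntegralControl.IsClosedLoopSolution f h B E Q K d r (Ici 0) x ξ ∧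
        ∀ b : ℝ, 0 < b → ∀ (x' : ℝ → (Fin n → ℝ)) (ξ' : ℝ → (Fin p → ℝ)),
          x' 0 = x₀ → ξ' 0 = ξ₀ →
          IntegralControl.IsClosedLoopSolution f h B E Q K d r (Ico 0 b) x' ξ' →
          EqOn x' x (Ico 0 b) ∧ EqOn ξ' ξ (Ico 0 b)) ∧
    -- every solution on `[0, ∞)` is bounded and its tracking error tends to zero
    (∀ (x : ℝ → (Fin n → ℝ)) (ξ : ℝ → (Fin p → ℝ)),
      IntegralControl.IsClosedLoopSolution f h B E Q K d r (Ici 0) x ξ →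
        (∃ M : ℝ, ∀ t : ℝ, 0 ≤ t → ‖x t‖ ≤ M ∧ ‖ξ t‖ ≤ M) ∧
        Tendsto (fun t => h (x t) - r) atTop (𝓝 0)) := by
  have hQd : Differentiable ℝ Q := hQ.differentiable one_ne_zero
  obtain ⟨LQ, hLQ⟩ := IntegralControl.exists_lipschitzWith_of_jacobian_le hQd hRQ
  have hfield := fun x ξ =>
    IntegralControl.closedLoop_eq_closedLoopField hf hh hexp hSDP d r x ξ
  rw [← hK] at hfield
  obtain ⟨e, κ, hκ, hdiss⟩ := hSDP.exists_inner_le hQd hRQ (Sum.elim (E *ᵥ d) (-r))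
  obtain ⟨L, hL⟩ := IntegralControl.exists_lipschitzWith_closedLoopField hLQ
    (IntegralControl.dataZ1 ts xₑ yₑ * (Y1 * P⁻¹)) (IntegralControl.dataZ1 ts xₑ yₑ * G2)
    (Sum.elim (E *ᵥ d) (-r))
  have hsmooth := IntegralControl.contDiff_closedLoopField hQ
    (IntegralControl.dataZ1 ts xₑ yₑ * (Y1 * P⁻¹)) (IntegralControl.dataZ1 ts xₑ yₑ * G2)
    (Sum.elim (E *ᵥ d) (-r))
  set v := IntegralControl.closedLoopField Q (IntegralControl.dataZ1 ts xₑ yₑ * (Y1 * P⁻¹))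
    (IntegralControl.dataZ1 ts xₑ yₑ * G2) (Sum.elim (E *ᵥ d) (-r))
  constructor
  · intro x₀ ξ₀
    obtain ⟨γ, hγ0, hγ⟩ :=
      IntegralControl.exists_hasDerivAt_of_lipschitz hsmooth hL (Sum.elim x₀ ξ₀)
    have hsplit : ∀ t, Sum.elim (γ t ∘ Sum.inl) (γ t ∘ Sum.inr) = γ t := fun t =>
      Sum.elim_comp_inl_inr _
    refine ⟨fun t => γ t ∘ Sum.inl, fun t => γ t ∘ Sum.inr, by simp [hγ0], by simp [hγ0],
      (IntegralControl.isClosedLoopSolution_iff hfield).2 fun t _ => ?_,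
      fun b _ x' ξ' hx' hξ' hsol => ?_⟩
    · simp only [hsplit]
      exact (hγ t).hasDerivWithinAt
    · have heq := IntegralControl.eqOn_Ico_of_lipschitz hL (by rw [hγ0, hx', hξ'])
        ((IntegralControl.isClosedLoopSolution_iff hfield).1 hsol)
        (fun t _ => (hγ t).hasDerivWithinAt)
      exact ⟨fun t ht => by simp [← heq ht], fun t ht => by simp [← heq ht]⟩
  · intro x ξ hsol
    obtain ⟨z, hz, hconv⟩ := IntegralControl.exists_equilibrium_tendsto hL e hκ hdiss
    obtain ⟨⟨M, hM⟩, hlim⟩ := hconv _ ((IntegralControl.isClosedLoopSolution_iff hfield).1 hsol)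
    have hM0 : 0 ≤ M := (norm_nonneg _).trans (hM 0 le_rfl)
    refine ⟨⟨M, fun t ht => ⟨?_, ?_⟩⟩, ?_⟩
    · exact (pi_norm_le_iff_of_nonneg hM0).2 fun i =>
        (norm_le_pi_norm (Sum.elim (x t) (ξ t)) (Sum.inl i)).trans (hM t ht)
    · exact (pi_norm_le_iff_of_nonneg hM0).2 fun i =>
        (norm_le_pi_norm (Sum.elim (x t) (ξ t)) (Sum.inr i)).trans (hM t ht)
    -- Integral action: the error is the `ξ` block of `v`, so by continuity it tends to that block
    -- of `v z = 0`.
    · have hout : ∀ t, h (x t) - r = v (Sum.elim (x t) (ξ t)) ∘ Sum.inr := fun t => by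
        rw [← hfield, Sum.elim_comp_inr]
      have hcont : Continuous fun w => v w ∘ (Sum.inr : Fin p → Fin n ⊕ Fin p) :=
        (Pi.continuous_precomp _).comp hL.continuous
      have h0 := (hcont.tendsto z).comp hlim
      rw [hz] at h0
      exact h0.congr fun t => (hout t).symm
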